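/- Let $f:\mathbb{R}\to\mathbb{R}\cup\{+\infty\}$ be convex and lower semicontinuous with $(0,\infty)\subseteq\operatorname{dom}(f):=\{t\in\mathbb{R}: f(t)<+\infty\}$. Let $f^*(z)=\sup_{t\in\operatorname{dom}(f)}\{tz-f(t)\}$ be its Fenchel conjugate, with domain $\operatorname{dom}(f^*)=\{z\in\mathbb{R}: f^*(z)<+\infty\}$. For nonnegative vectors $P,Q$ on a discrete (finite or countable) set $\mathcal{X}$ put $S_f(P\|Q)=\sum_{x\in\mathcal X} Q(x)\,f\!\left(\frac{P(x)}{Q(x)}\right)\in(-\infty,+\infty]$, with the conventions $f(0)=\lim_{t\downarrow0}f(t)$, $0f(\tfrac00)=0$ and $0f(\tfrac a0)=\lim_{t\downarrow0}t f(\tfrac at)$ for $a>0$. For positive semidefinite operators $\rho,\sigma$ on a finite-dimensional complex Hilbert space define $$S_{\mathbb M,f}(\rho\|\sigma)=\sup_{M\text{ POVM}}S_f(P_{\rho,M}\|P_{\sigma,M}),\qquad S^{\mathbb P}_{\mathbb M,f}(\rho\|\sigma)=\sup_{M\text{ PVM}}S_f(P_{\rho,M}\|P_{\sigma,M}),\qquad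 P_{\rho,M}(x)=\operatorname{tr}[\rho M_x],$$ where a POVM is a family $\{M_x\}_{x\in\mathcal X}$ of positive semidefinite operators, indexed by a discrete set $\mathcal X$, with $\sum_x M_x=I$, and a PVM is a POVM all of whose elements $M_x$ are orthogonal projectors. A function $g:J\to\mathbb{R}$ on an interval $J\subseteq\mathbb R$ is operator convex if $g(tA+(1-t)B)\le t\,g(A)+(1-t)\,g(B)$ in the Loewner order for all $t\in[0,1]$ and all Hermitian matrices $A,B$, of every size, with spectrum in $J$; it is operator concave if $-g$ is operator convex. Theorem. Suppose that there are an interval $J\subseteq\mathbb R$ and a one-to-one correspondence (bijection) $\psi:J\to\operatorname{dom}(f^*)$ such that $\psi$ is operator concave on $J$ and $f^*\circ\psi$ is operator convex on $J$. Then for all positive semidefinite $\rho,\sigma$ $$S_{\mathbb M,f}(\rho\|\sigma)=S^{\mathbb P}_{\mathbb M,f}(\rho\|\sigma)=\sup_{\gamma\text{ Hermitian},\ \operatorname{spec}(\gamma)\subseteq J}\Big\{\operatorname{tr}[\rho\,\psi(\gamma)]-\operatorname{tr}[\sigma\,(f^*\circ\psi)(\gamma)]\Big\}.$$ -/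

import Mathlib

open Filter Topology
open scoped ComplexOrder

noncomputable section

namespace MeasuredDivergence

/-- Effective domain of an extended-real-valued function on the line. -/
def dom (f : ℝ → EReal) : Set ℝ := {t | f t < ⊤}

/-- Convexity of a function `ℝ → ℝ ∪ {+∞}` (in `EReal`, `0 * ⊤ = 0`; the value `⊥` is excluded
separately wherever this is used). -/
def IsConvexFun (f : ℝ → EReal) : Prop :=
  ∀ x y a b : ℝ, 0 ≤ a → 0 ≤ b → a + b = 1 →
    f (a * x + b * y) ≤ (a : EReal) * f x + (b : EReal) * f y

/-- The Fenchel conjugate `f^*(z) = sup_{t ∈ dom f} (t z - f t)`. -/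
def fenchel (f : ℝ → EReal) (z : ℝ) : EReal :=
  ⨆ t ∈ dom f, (((t * z : ℝ) : EReal) - f t)

/-- The summand `q f(p / q)` of an `f`-divergence, with the conventions
`f(0) = lim_{t ↓ 0} f(t)`, `0 f(0/0) = 0` and `0 f(p/0) = lim_{t ↓ 0} t f(p/t)` for `p > 0`.
Both limits exist in `(-∞, +∞]` when `f` is convex and finite on `(0, ∞)`. -/
def divTerm (f : ℝ → EReal) (p q : ℝ) : EReal :=
  open Classical in
  if q = 0 then
    if p = 0 then 0 else limUnder (𝓝[>] (0 : ℝ)) (fun t : ℝ => (t : EReal) * f (p / t))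
  else if p = 0 then (q : EReal) * limUnder (𝓝[>] (0 : ℝ)) f
  else (q : EReal) * f (p / q)

/-- The classical `f`-divergence of two summable nonnegative vectors on a discrete set.
A convex `f` has an affine minorant, so every summand is bounded below by `a * P x + b * Q x`
and the (unconditional) sum always converges in `(-∞, +∞]`. -/
def fDiv {X : Type} (f : ℝ → EReal) (P Q : X → ℝ) : EReal :=
  ∑' x, divTerm f (P x) (Q x)

variable {d : Type*} [Fintype d] [DecidableEq d]

/-- Positive operator-valued measures with a discrete set of outcomes. -/
def IsPOVM {X : Type} (M : X → Matrix d d ℂ) : Prop :=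
  (∀ x, (M x).PosSemidef) ∧ HasSum M 1

/-- Projection-valued measures: POVMs all of whose elements are orthogonal projectors. -/
def IsPVM {X : Type} (M : X → Matrix d d ℂ) : Prop :=
  IsPOVM M ∧ ∀ x, IsStarProjection (M x)

/-- Outcome vector `P_{ρ,M}(x) = tr[ρ M_x]` (a real number for Hermitian `ρ` and `M_x`). -/
def outcome {X : Type} (ρ : Matrix d d ℂ) (M : X → Matrix d d ℂ) (x : X) : ℝ :=
  (ρ * M x).trace.re

/-- The measured `f`-divergence: supremum over all POVMs. -/
def measuredDiv (f : ℝ → EReal) (ρ σ : Matrix d d ℂ) : EReal :=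
  sSup {v | ∃ (X : Type) (_ : Countable X) (M : X → Matrix d d ℂ),
    IsPOVM M ∧ v = fDiv f (outcome ρ M) (outcome σ M)}

/-- The projectively measured `f`-divergence: supremum over all PVMs. -/
def measuredDivProj (f : ℝ → EReal) (ρ σ : Matrix d d ℂ) : EReal :=
  sSup {v | ∃ (X : Type) (_ : Countable X) (M : X → Matrix d d ℂ),
    IsPVM M ∧ v = fDiv f (outcome ρ M) (outcome σ M)}

/-- Operator convexity of `g` on `J`: convexity in the Loewner order on Hermitian matrices, of every
size, with spectrum in `J`. The functional calculus `cfc g A` depends only on `g` on the (finite)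
spectrum of `A`, where every function is continuous. -/
def OperatorConvexOn (J : Set ℝ) (g : ℝ → ℝ) : Prop :=
  ∀ (n : ℕ) (A B : Matrix (Fin n) (Fin n) ℂ), A.IsHermitian → B.IsHermitian →
    spectrum ℝ A ⊆ J → spectrum ℝ B ⊆ J → ∀ t : ℝ, 0 ≤ t → t ≤ 1 →
      (t • cfc g A + (1 - t) • cfc g B - cfc g (t • A + (1 - t) • B)).PosSemidef

/-- Operator concavity of `g` on `J`. -/
def OperatorConcaveOn (J : Set ℝ) (g : ℝ → ℝ) : Prop :=
  OperatorConvexOn J (fun x => - g x)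

end MeasuredDivergence

end

/-! Biconjugation gives q f(p/q) = sup of p z − q f*(z) over z in dom f*, and the conventions at p =
0 and q = 0 are exactly what extends this to the closed quadrant (`divTerm_eq_iSup`). Substituting z
= ψ(l) turns the divergence of a measurement M into a supremum, over labels l_x in J, of the sum of
tr[ρ M_x] ψ(l_x) − tr[σ M_x] f*(ψ(l_x)).

For a finite POVM put γ = Σ l_x M_x. The operator Jensen inequality gives Σ ψ(l_x) M_x ≤ ψ(γ) and Σ
f*(ψ(l_x)) M_x ≥ f*(ψ(γ)), so the labelled sum is at most the variational expression at γ
(`sum_le_trace_cfc`). Countable POVMs reduce to finite ones by lumping a tail into one effect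
(`fDiv_le_iSup_trace_cfc`). Conversely, measuring in an eigenbasis of γ with the eigenvalues as
labels shows that PVMs already reach the expression (`trace_cfc_le_measuredDivProj`). Hence PVM ≤
POVM ≤ variational ≤ PVM. -/

namespace MeasuredDivergence

/-! ### Functional calculus, dilation and the operator Jensen inequality. -/

section Matrices

variable {d m : Type*} [Fintype d] [DecidableEq d] [Fintype m] [DecidableEq m]

/-- On a Hermitian matrix the functional calculus agrees with a polynomial, which can be chosen
simultaneously for two matrices. -/
lemma exists_polynomial_cfc_eq (g : ℝ → ℝ) {A : Matrix m m ℂ} {B : Matrix d d ℂ}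
    (hA : A.IsHermitian) (hB : B.IsHermitian) :
    ∃ q : Polynomial ℝ, cfc g A = Polynomial.aeval A q ∧ cfc g B = Polynomial.aeval B q := by
  have hfA : (spectrum ℝ A).Finite := Matrix.finite_real_spectrum
  have hfB : (spectrum ℝ B).Finite := Matrix.finite_real_spectrum
  let s : Finset ℝ := (hfA.union hfB).toFinset
  let q := Lagrange.interpolate s id g
  have hq : ∀ x ∈ s, g x = q.eval x := fun x hx =>
    (Lagrange.eval_interpolate_at_node g (Set.injOn_id _) hx).symm
  refine ⟨q, ?_, ?_⟩
  · rw [← cfc_polynomial q A hA]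
    exact cfc_congr fun x hx => hq x (by simp [s, hx])
  · rw [← cfc_polynomial q B hB]
    exact cfc_congr fun x hx => hq x (by simp [s, hx])

lemma aeval_mul_of_intertwine {A : Matrix m m ℂ} {B : Matrix d d ℂ} {V : Matrix m d ℂ}
    (h : A * V = V * B) (q : Polynomial ℝ) :
    Polynomial.aeval A q * V = V * Polynomial.aeval B q := by
  have hpow : ∀ k : ℕ, A ^ k * V = V * B ^ k := by
    intro k
    induction k with
    | zero => simp
    | succ k ih => rw [pow_succ, Matrix.mul_assoc, h, ← Matrix.mul_assoc, ih, Matrix.mul_assoc,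
        ← pow_succ]
  induction q using Polynomial.induction_on' with
  | add p q hp hq => simp [Matrix.add_mul, Matrix.mul_add, hp, hq]
  | monomial k a => simp [Polynomial.aeval_monomial, Algebra.algebraMap_eq_smul_one, hpow]

/-- The functional calculus respects intertwiners. -/
lemma cfc_mul_of_intertwine (g : ℝ → ℝ) {A : Matrix m m ℂ} {B : Matrix d d ℂ} {V : Matrix m d ℂ}
    (hA : A.IsHermitian) (hB : B.IsHermitian) (h : A * V = V * B) :
    cfc g A * V = V * cfc g B := by
  obtain ⟨q, h1, h2⟩ := exists_polynomial_cfc_eq g hA hB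
  rw [h1, h2, aeval_mul_of_intertwine h]

omit [Fintype m] in
lemma isHermitian_diagonal_real (l : m → ℝ) :
    (Matrix.diagonal fun i => (l i : ℂ)).IsHermitian :=
  Matrix.isHermitian_diagonal_of_self_adjoint _ (by ext i; simp [Pi.star_apply])

lemma cfc_diagonal_real (g : ℝ → ℝ) (l : m → ℝ) :
    cfc g (Matrix.diagonal fun i => (l i : ℂ)) = Matrix.diagonal fun i => (g (l i) : ℂ) := by
  obtain ⟨q, hq⟩ : ∃ q : Polynomial ℝ, ∀ i, q.eval (l i) = g (l i) :=
    ⟨Lagrange.interpolate (Finset.univ.image l) id g, fun i =>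
      Lagrange.eval_interpolate_at_node g (Set.injOn_id _) (by simp)⟩
  have hH := isHermitian_diagonal_real l
  have hsp : spectrum ℝ (Matrix.diagonal fun i => (l i : ℂ)) ⊆ Set.range l := by
    intro x hx
    rw [← spectrum.algebraMap_mem_iff ℂ, spectrum_diagonal] at hx
    obtain ⟨i, hi⟩ := hx
    exact ⟨i, by simpa using hi⟩
  have hcongr : cfc g (Matrix.diagonal fun i => (l i : ℂ))
      = cfc q.eval (Matrix.diagonal fun i => (l i : ℂ)) :=
    cfc_congr fun x hx => by obtain ⟨i, rfl⟩ := hsp hx; exact (hq i).symm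
  have hpoly := cfc_polynomial q (Matrix.diagonal fun i => (l i : ℂ)) hH.isSelfAdjoint
  rw [hcongr, hpoly]
  simp only [← hq]
  clear hcongr hpoly hH hsp hq
  induction q using Polynomial.induction_on' with
  | add p q hp hq => simp [hp, hq, Matrix.diagonal_add]
  | monomial k a =>
    simp [Polynomial.aeval_monomial, Matrix.diagonal_pow, Algebra.algebraMap_eq_smul_one,
      ← Matrix.diagonal_smul]

lemma spectrum_diagonal_real_subset {J : Set ℝ} {l : m → ℝ} (hl : ∀ i, l i ∈ J) :
    spectrum ℝ (Matrix.diagonal fun i => (l i : ℂ)) ⊆ J := by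
  intro x hx
  rw [← spectrum.algebraMap_mem_iff ℂ, spectrum_diagonal] at hx
  obtain ⟨i, hi⟩ := hx
  have : l i = x := by simpa using hi
  exact this ▸ hl i

/-- **Operator Jensen inequality** for the compression of a real diagonal matrix by an isometry. -/
lemma OperatorConvexOn.isometry_compression {J : Set ℝ} {g : ℝ → ℝ} (hg : OperatorConvexOn J g)
    {n : ℕ} {l : Fin n → ℝ} (hl : ∀ i, l i ∈ J) {V : Matrix (Fin n) d ℂ}
    (hV : V.conjTranspose * V = 1) :
    (V.conjTranspose * Matrix.diagonal (fun i => (g (l i) : ℂ)) * V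
      - cfc g (V.conjTranspose * Matrix.diagonal (fun i => (l i : ℂ)) * V)).PosSemidef := by
  set D : Matrix (Fin n) (Fin n) ℂ := Matrix.diagonal fun i => (l i : ℂ) with hD
  have hDH : D.IsHermitian := isHermitian_diagonal_real l
  set P := V * V.conjTranspose with hP
  -- `W` is the reflection in the range of `V`, a self-inverse unitary, so `W * D * W` has the
  -- spectrum of `D`. The midpoint of the two is the pinching P D P + (1 − P) D (1 − P), which
  -- leaves the range of `V` invariant and acts there as the compression of `D`.
  set W := (2 : ℝ) • P - 1 with hW
  have hPP : P * P = P := by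
    rw [hP, Matrix.mul_assoc, ← Matrix.mul_assoc _ V, hV, Matrix.one_mul]
  have hPH : P.IsHermitian := Matrix.isHermitian_mul_conjTranspose_self V
  have hWH : W.IsHermitian := by
    simp only [hW, Matrix.IsHermitian, Matrix.conjTranspose_sub, Matrix.conjTranspose_smul, hPH.eq,
      Matrix.conjTranspose_one, star_trivial]
  have hWW : W * W = 1 := by
    simp only [hW, sub_mul, mul_sub, smul_mul_assoc, mul_smul_comm, hPP, one_mul, mul_one]
    module
  have hWV : W * V = V := by
    have : P * V = V := by rw [hP, Matrix.mul_assoc, hV, Matrix.mul_one]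
    simp only [hW, Matrix.sub_mul, Matrix.smul_mul, this, Matrix.one_mul]
    module
  have hVW : V.conjTranspose * W = V.conjTranspose := by
    simpa [hWH.eq] using congr_arg Matrix.conjTranspose hWV
  have hE : (W * D * W).IsHermitian := by
    simp only [Matrix.IsHermitian, Matrix.conjTranspose_mul, hWH.eq, hDH.eq, Matrix.mul_assoc]
  have hγ : (V.conjTranspose * D * V).IsHermitian := by
    simp [Matrix.IsHermitian, Matrix.conjTranspose_mul, hDH.eq, Matrix.mul_assoc]
  have hspE : spectrum ℝ (W * D * W) ⊆ J := by
    have := spectrum.units_conjugate (R := ℝ) (a := D) (u := ⟨W, W, hWW, hWW⟩)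
    simp only [Units.inv_mk] at this
    rw [this]
    exact spectrum_diagonal_real_subset hl
  have hE' : cfc g (W * D * W) = W * cfc g D * W := by
    have h := cfc_mul_of_intertwine g hE hDH (V := W) (by rw [mul_assoc, hWW, mul_one])
    rw [← h, mul_assoc _ W W, hWW, mul_one]
  have key := hg n D (W * D * W) hDH hE (spectrum_diagonal_real_subset hl) hspE (1 / 2)
    (by norm_num) (by norm_num)
  set Z := (1 / 2 : ℝ) • D + (1 - 1 / 2 : ℝ) • (W * D * W) with hZ
  have hZH : Z.IsHermitian := by
    simp only [hZ, Matrix.IsHermitian, Matrix.conjTranspose_add, Matrix.conjTranspose_smul, hDH.eq,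
      hE.eq, star_trivial]
  have hZV : Z * V = V * (V.conjTranspose * D * V) := by
    have h1 : W * D * W * V = (2 : ℝ) • (V * (V.conjTranspose * D * V)) - D * V := by
      rw [Matrix.mul_assoc, hWV, hW, hP]
      simp only [Matrix.sub_mul, Matrix.smul_mul, Matrix.one_mul, Matrix.mul_assoc]
    rw [hZ, Matrix.add_mul, Matrix.smul_mul, Matrix.smul_mul, h1]
    module
  have hgZ := cfc_mul_of_intertwine g hZH hγ hZV
  have := key.conjTranspose_mul_mul_same V
  rw [hE', hD, cfc_diagonal_real g l] at this
  convert this using 1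
  have h2 : V.conjTranspose * cfc g Z * V = cfc g (V.conjTranspose * D * V) := by
    rw [Matrix.mul_assoc, hgZ, ← Matrix.mul_assoc, hV, Matrix.one_mul]
  -- `W` fixes `V`, so both endpoints of the midpoint inequality have the same compression.
  have h3 : ∀ G : Matrix (Fin n) (Fin n) ℂ,
      V.conjTranspose * (W * G * W) * V = V.conjTranspose * G * V := by
    intro G
    rw [Matrix.mul_assoc, Matrix.mul_assoc (W * G), hWV, ← Matrix.mul_assoc, ← Matrix.mul_assoc,
      hVW]
  rw [Matrix.mul_sub, Matrix.sub_mul, h2, Matrix.mul_add, Matrix.add_mul, Matrix.mul_smul,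
    Matrix.smul_mul, Matrix.mul_smul, Matrix.smul_mul, h3]
  module

/-- An eigenvalue is the Rayleigh quotient at a unit eigenvector v. With w = V v, again a unit
vector, it is the convex combination of the `l j` with weights |w_j|². -/
lemma spectrum_isometry_compression_subset {J : Set ℝ} (hJ : J.OrdConnected) {l : m → ℝ}
    (hl : ∀ i, l i ∈ J) {V : Matrix m d ℂ} (hV : V.conjTranspose * V = 1) :
    spectrum ℝ (V.conjTranspose * Matrix.diagonal (fun i => (l i : ℂ)) * V) ⊆ J := by
  have hγ : (V.conjTranspose * Matrix.diagonal (fun i => (l i : ℂ)) * V).IsHermitian := by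
    simp [Matrix.IsHermitian, Matrix.conjTranspose_mul, (isHermitian_diagonal_real l).eq,
      Matrix.mul_assoc]
  rw [hγ.spectrum_real_eq_range_eigenvalues]
  rintro _ ⟨i, rfl⟩
  rw [hγ.eigenvalues_eq]
  set v : d → ℂ := ⇑(hγ.eigenvectorBasis i)
  have hv : star v ⬝ᵥ v = 1 := by
    have := hγ.eigenvectorBasis.orthonormal.1 i
    have h2 : inner ℂ (hγ.eigenvectorBasis i) (hγ.eigenvectorBasis i) = (1 : ℂ) := by
      rw [inner_self_eq_norm_sq_to_K, this]; simp
    rw [EuclideanSpace.inner_eq_star_dotProduct] at h2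
    rw [dotProduct_comm]; exact h2
  set w := V.mulVec v with hw
  have hww : ∑ j, Complex.normSq (w j) = 1 := by
    have : star w ⬝ᵥ w = 1 := by
      rw [hw, Matrix.star_mulVec, ← Matrix.dotProduct_mulVec, Matrix.mulVec_mulVec, hV,
        Matrix.one_mulVec, hv]
    have h3 := congr_arg Complex.re this
    simpa [dotProduct, Complex.normSq_apply] using h3
  have hval : star v ⬝ᵥ (V.conjTranspose * Matrix.diagonal (fun i => (l i : ℂ)) * V).mulVec v
      = star w ⬝ᵥ (Matrix.diagonal (fun i => (l i : ℂ))).mulVec w := by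
    rw [hw, Matrix.star_mulVec, ← Matrix.dotProduct_mulVec, Matrix.mulVec_mulVec,
      Matrix.mulVec_mulVec, Matrix.mul_assoc]
  rw [hval]
  have hsum : RCLike.re (star w ⬝ᵥ (Matrix.diagonal (fun i => (l i : ℂ))).mulVec w)
      = ∑ j, Complex.normSq (w j) • l j := by
    simp only [dotProduct, Matrix.mulVec_diagonal, Pi.star_apply, RCLike.re_eq_complex_re,
      Complex.re_sum, smul_eq_mul]
    refine Finset.sum_congr rfl fun j _ => ?_
    simp [Complex.normSq_apply]; ring
  rw [hsum]
  exact hJ.convex.sum_mem (fun j _ => Complex.normSq_nonneg _) hww fun j _ => hl j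

/-- With B = C* C, cyclicity turns the trace into that of C A C*. -/
lemma trace_mul_re_nonneg {A B : Matrix d d ℂ} (hA : A.PosSemidef) (hB : B.PosSemidef) :
    0 ≤ (A * B).trace.re := by
  obtain ⟨C, rfl⟩ : ∃ C : Matrix d d ℂ, B = C.conjTranspose * C := by
    open scoped MatrixOrder in
    exact (CStarAlgebra.nonneg_iff_eq_star_mul_self (a := B)).1 hB.nonneg
  rw [← Matrix.mul_assoc, Matrix.trace_mul_comm, ← Matrix.mul_assoc]
  exact (Complex.le_def.1 (hA.mul_mul_conjTranspose_same C).trace_nonneg).1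

/-- A finite positive operator-valued measure is the compression of a projective one: weighted sums
of its elements are compressions of diagonal matrices by an isometry. -/
lemma exists_isometry_of_sum_eq_one {ι : Type*} [Fintype ι] {M : ι → Matrix d d ℂ}
    (hM : ∀ i, (M i).PosSemidef) (hsum : ∑ i, M i = 1) :
    ∃ (n : ℕ) (k : Fin n → ι) (V : Matrix (Fin n) d ℂ), V.conjTranspose * V = 1 ∧
      ∀ l : ι → ℝ, V.conjTranspose * Matrix.diagonal (fun j => (l (k j) : ℂ)) * V
        = ∑ i, l i • M i := by
  have hC : ∀ i, ∃ C : Matrix d d ℂ, M i = C.conjTranspose * C := fun i => by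
    open scoped MatrixOrder in
    exact (CStarAlgebra.nonneg_iff_eq_star_mul_self (a := M i)).1 (hM i).nonneg
  choose C hC using hC
  let e := Fintype.equivFin (d × ι)
  -- Naimark dilation: the factors `C i` of M_i = C_i* C_i are stacked vertically, and every row of
  -- block i carries the label `l i`.
  let V : Matrix (Fin (Fintype.card (d × ι))) d ℂ :=
    Matrix.of fun j a => C (e.symm j).2 (e.symm j).1 a
  have hmain : ∀ l : ι → ℝ,
      V.conjTranspose * Matrix.diagonal (fun j => (l (e.symm j).2 : ℂ)) * V = ∑ i, l i • M i := by
    intro l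
    ext a b
    rw [Matrix.mul_apply, Matrix.sum_apply]
    simp only [Matrix.mul_diagonal, V, Matrix.conjTranspose_apply, Matrix.of_apply]
    rw [e.symm.sum_comp (fun y : d × ι => star (C y.2 y.1 a) * (l y.2 : ℂ) * C y.2 y.1 b),
      Fintype.sum_prod_type_right]
    refine Finset.sum_congr rfl fun i _ => ?_
    rw [Matrix.smul_apply, hC i, Matrix.mul_apply, Finset.smul_sum]
    refine Finset.sum_congr rfl fun c _ => ?_
    simp only [Matrix.conjTranspose_apply, Complex.real_smul]
    ring
  refine ⟨_, fun j => (e.symm j).2, V, ?_, hmain⟩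
  have := hmain fun _ => 1
  simpa [hsum, Matrix.diagonal_one] using this

/-- Operator Jensen inequality for a finite positive operator-valued measure. -/
lemma OperatorConvexOn.sum_smul_sub_cfc_posSemidef {J : Set ℝ} {g : ℝ → ℝ}
    (hg : OperatorConvexOn J g) {ι : Type*} [Fintype ι] {M : ι → Matrix d d ℂ}
    (hM : ∀ i, (M i).PosSemidef) (hsum : ∑ i, M i = 1) {l : ι → ℝ} (hl : ∀ i, l i ∈ J) :
    (∑ i, g (l i) • M i - cfc g (∑ i, l i • M i)).PosSemidef := by
  obtain ⟨n, k, V, hV, h⟩ := exists_isometry_of_sum_eq_one hM hsum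
  have := hg.isometry_compression (l := fun j => l (k j)) (fun j => hl _) hV
  rwa [h l, h fun i => g (l i)] at this

lemma spectrum_sum_smul_subset {J : Set ℝ} (hJ : J.OrdConnected) {ι : Type*} [Fintype ι]
    {M : ι → Matrix d d ℂ} (hM : ∀ i, (M i).PosSemidef) (hsum : ∑ i, M i = 1) {l : ι → ℝ}
    (hl : ∀ i, l i ∈ J) : spectrum ℝ (∑ i, l i • M i) ⊆ J := by
  obtain ⟨n, k, V, hV, h⟩ := exists_isometry_of_sum_eq_one hM hsum
  have := spectrum_isometry_compression_subset hJ (l := fun j => l (k j)) (fun j => hl _) hV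
  rwa [h l] at this

/-- The rank-one spectral resolution of a Hermitian matrix, indexed by a type in `Type`. -/
lemma exists_spectral_resolution {γ : Matrix d d ℂ} (hγ : γ.IsHermitian) :
    ∃ (n : ℕ) (l : Fin n → ℝ) (M : Fin n → Matrix d d ℂ), IsPVM M ∧
      (∀ i, l i ∈ spectrum ℝ γ) ∧ ∀ g : ℝ → ℝ, cfc g γ = ∑ i, g (l i) • M i := by
  let e := Fintype.equivFin d
  let U : Matrix d d ℂ := hγ.eigenvectorUnitary
  have hUU : U * U.conjTranspose = 1 := Unitary.coe_mul_star_self hγ.eigenvectorUnitary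
  have hUU' : U.conjTranspose * U = 1 := Unitary.coe_star_mul_self hγ.eigenvectorUnitary
  let N : d → Matrix d d ℂ := fun a => U * Matrix.diagonal (Pi.single a 1) * U.conjTranspose
  have hN : ∀ c : d → ℂ, ∑ a, c a • N a = U * Matrix.diagonal c * U.conjTranspose := by
    intro c
    have : Matrix.diagonal c = ∑ a, c a • Matrix.diagonal (Pi.single a (1 : ℂ)) := by
      simp only [← Matrix.diagonal_smul]
      ext i j
      by_cases hij : i = j
      · subst hij
        simp [Matrix.sum_apply, Pi.single_apply]
      · simp [Matrix.sum_apply, Matrix.diagonal_apply_ne _ hij]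
    rw [this, Matrix.mul_sum, Matrix.sum_mul]
    simp [N]
  have hNherm : ∀ a, (N a).IsHermitian := by
    intro a
    have : (Matrix.diagonal (Pi.single a (1 : ℂ))).conjTranspose
        = Matrix.diagonal (Pi.single a (1 : ℂ)) := by
      rw [Matrix.diagonal_conjTranspose]; congr 1; ext i
      by_cases h : i = a <;> simp [h]
    simp only [N, Matrix.IsHermitian, Matrix.conjTranspose_mul, Matrix.conjTranspose_conjTranspose,
      this, Matrix.mul_assoc]
  have hNidem : ∀ a, N a * N a = N a := by
    intro a
    have : Matrix.diagonal (Pi.single a (1 : ℂ)) * Matrix.diagonal (Pi.single a (1 : ℂ))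
        = Matrix.diagonal (Pi.single a (1 : ℂ)) := by
      rw [Matrix.diagonal_mul_diagonal]; congr 1; ext i
      by_cases h : i = a <;> simp [h]
    calc N a * N a = U * (Matrix.diagonal (Pi.single a 1) * (U.conjTranspose * U)
          * Matrix.diagonal (Pi.single a 1)) * U.conjTranspose := by
          simp only [N, Matrix.mul_assoc]
      _ = N a := by rw [hUU', Matrix.mul_one, this]
  refine ⟨Fintype.card d, fun i => hγ.eigenvalues (e.symm i), fun i => N (e.symm i),
    ⟨⟨fun i => ?_, ?_⟩, fun i => ⟨hNidem _, hNherm _⟩⟩,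
    fun i => hγ.eigenvalues_mem_spectrum_real _, fun g => ?_⟩
  · have := Matrix.posSemidef_conjTranspose_mul_self (N (e.symm i))
    rwa [(hNherm _).eq, hNidem] at this
  · have h1 : ∑ i, N (e.symm i) = 1 := by
      rw [e.symm.sum_comp N]
      have := hN fun _ => 1
      simpa [hUU] using this
    exact h1 ▸ hasSum_fintype _
  · rw [hγ.cfc_eq, Matrix.IsHermitian.cfc, Unitary.conjStarAlgAut_apply,
      e.symm.sum_comp fun a => g (hγ.eigenvalues a) • N a]
    have := hN fun a => (g (hγ.eigenvalues a) : ℂ)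
    simp only [Complex.coe_smul] at this
    rw [this]
    rfl

end Matrices

/-! ### Scalar conjugate duality on the closed quadrant. -/

section Fenchel

variable {f : ℝ → EReal}

lemma coe_toReal_of_mem_dom (hbot : ∀ t, f t ≠ ⊥) {t : ℝ} (ht : t ∈ dom f) :
    ((f t).toReal : EReal) = f t :=
  EReal.coe_toReal ht.ne (hbot t)

lemma fenchel_ne_bot (hbot : ∀ t, f t ≠ ⊥) (hdom : Set.Ioi (0 : ℝ) ⊆ dom f) (z : ℝ) :
    fenchel f z ≠ ⊥ := by
  have h1 : (1 : ℝ) ∈ dom f := hdom (by simp)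
  have : ((1 * z : ℝ) : EReal) - f 1 ≤ fenchel f z :=
    le_iSup₂ (f := fun t (_ : t ∈ dom f) => (((t * z : ℝ) : EReal) - f t)) 1 h1
  rw [← coe_toReal_of_mem_dom hbot h1, ← EReal.coe_sub] at this
  exact ((EReal.bot_lt_coe _).trans_le this).ne'

/-- The Fenchel–Young inequality. -/
lemma fenchel_young (hbot : ∀ t, f t ≠ ⊥) {t z : ℝ} (ht : t ∈ dom f)
    (hz : z ∈ dom (fenchel f)) : t * z - (f t).toReal ≤ (fenchel f z).toReal := by
  have : ((t * z : ℝ) : EReal) - f t ≤ fenchel f z :=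
    le_iSup₂ (f := fun t (_ : t ∈ dom f) => (((t * z : ℝ) : EReal) - f t)) t ht
  rw [← coe_toReal_of_mem_dom hbot ht, ← EReal.coe_sub] at this
  have h2 := EReal.toReal_le_toReal this (EReal.coe_ne_bot _) (ne_of_lt hz)
  rwa [EReal.toReal_coe] at h2

lemma IsConvexFun.convexOn_toReal (hbot : ∀ t, f t ≠ ⊥) (hf : IsConvexFun f) :
    ConvexOn ℝ (dom f) fun t => (f t).toReal := by
  have key : ∀ x ∈ dom f, ∀ y ∈ dom f, ∀ a b : ℝ, 0 ≤ a → 0 ≤ b → a + b = 1 →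
      f (a * x + b * y) ≤ ((a * (f x).toReal + b * (f y).toReal : ℝ) : EReal) := by
    intro x hx y hy a b ha hb hab
    have := hf x y a b ha hb hab
    rwa [← coe_toReal_of_mem_dom hbot hx, ← coe_toReal_of_mem_dom hbot hy, ← EReal.coe_mul,
      ← EReal.coe_mul, ← EReal.coe_add] at this
  refine ⟨fun x hx y hy a b ha hb hab => ?_, fun x hx y hy a b ha hb hab => ?_⟩
  · exact (key x hx y hy a b ha hb hab).trans_lt (EReal.coe_lt_top _)
  · exact (EReal.toReal_le_toReal (key x hx y hy a b ha hb hab) (hbot _)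
      (EReal.coe_ne_top _)).trans_eq (EReal.toReal_coe _)

/-- A convex function finite on `(0, ∞)` has a subgradient at every positive point. -/
lemma exists_fenchel_eq (hbot : ∀ t, f t ≠ ⊥) (hf : IsConvexFun f)
    (hdom : Set.Ioi (0 : ℝ) ⊆ dom f) {t : ℝ} (ht : 0 < t) :
    ∃ z ∈ dom (fenchel f), (fenchel f z).toReal = t * z - (f t).toReal := by
  have hc := hf.convexOn_toReal hbot
  have htd : t ∈ dom f := hdom ht
  -- The subgradient is the supremum of the slopes to the left of `t`; every slope to the right
  -- bounds it.
  let A : Set ℝ := {y | ∃ s ∈ dom f, s < t ∧ y = ((f t).toReal - (f s).toReal) / (t - s)}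
  have hAB : ∀ u ∈ dom f, t < u → ∀ y ∈ A, y ≤ ((f u).toReal - (f t).toReal) / (u - t) := by
    rintro u hu htu _ ⟨s, hs, hst, rfl⟩
    exact hc.slope_mono_adjacent hs hu hst htu
  have hA : A.Nonempty := ⟨_, t / 2, hdom (by simp [ht]), by linarith, rfl⟩
  have hAb : BddAbove A := ⟨_, fun y hy => hAB (t + 1) (hdom (by simp; linarith)) (by linarith) y hy⟩
  let z := sSup A
  have hsub : ∀ s ∈ dom f, s * z - (f s).toReal ≤ t * z - (f t).toReal := by
    intro s hs
    rcases lt_trichotomy s t with h | h | h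
    · have := le_csSup hAb ⟨s, hs, h, rfl⟩
      rw [div_le_iff₀ (by linarith)] at this
      change _ ≤ z * _ at this
      linarith
    · rw [h]
    · have : z ≤ _ := csSup_le hA (hAB s hs h)
      rw [le_div_iff₀ (by linarith)] at this
      linarith
  have hle : fenchel f z ≤ ((t * z - (f t).toReal : ℝ) : EReal) := by
    refine iSup₂_le fun s hs => ?_
    rw [← coe_toReal_of_mem_dom hbot hs, ← EReal.coe_sub]
    exact_mod_cast hsub s hs
  have hz : z ∈ dom (fenchel f) := hle.trans_lt (EReal.coe_lt_top _)
  refine ⟨z, hz, le_antisymm ?_ (fenchel_young hbot htd hz)⟩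
  exact (EReal.toReal_le_toReal hle (fenchel_ne_bot hbot hdom z)
    (EReal.coe_ne_top _)).trans_eq (EReal.toReal_coe _)

lemma tendsto_coe_nhdsGT_zero {u : ℝ → ℝ} (hu : Continuous u) :
    Tendsto (fun t => (u t : EReal)) (𝓝[>] 0) (𝓝 (u 0 : EReal)) :=
  ((continuous_coe_real_ereal.comp hu).tendsto 0).mono_left nhdsWithin_le_nhds

/-- Lower semicontinuity bounds the limit from below. When f(0) is finite, the chord from 0 to 1
bounds it from above. -/
lemma tendsto_nhdsGT_zero (hbot : ∀ t, f t ≠ ⊥) (hf : IsConvexFun f) (hlsc : LowerSemicontinuous f)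
    (hdom : Set.Ioi (0 : ℝ) ⊆ dom f) : Tendsto f (𝓝[>] (0 : ℝ)) (𝓝 (f 0)) := by
  rw [tendsto_order]
  refine ⟨fun c hc => nhdsWithin_le_nhds (hlsc 0 c hc), fun c hc => ?_⟩
  have h0 : (0 : ℝ) ∈ dom f := lt_top_of_lt hc
  have h1 : (1 : ℝ) ∈ dom f := hdom (by simp)
  have hlim : Tendsto (fun t : ℝ => (((1 - t) * (f 0).toReal + t * (f 1).toReal : ℝ) : EReal))
      (𝓝[>] 0) (𝓝 (f 0)) := by
    convert tendsto_coe_nhdsGT_zero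
      (u := fun t : ℝ => (1 - t) * (f 0).toReal + t * (f 1).toReal) (by fun_prop) using 2
    rw [← coe_toReal_of_mem_dom hbot h0]
    simp
  filter_upwards [hlim.eventually_lt_const hc, Ioo_mem_nhdsGT (zero_lt_one' ℝ)] with t ht hI
  refine lt_of_le_of_lt ?_ ht
  have := hf 0 1 (1 - t) t (by linarith [hI.2]) hI.1.le (by ring)
  rw [← coe_toReal_of_mem_dom hbot h0, ← coe_toReal_of_mem_dom hbot h1, ← EReal.coe_mul,
      ← EReal.coe_mul, ← EReal.coe_add] at this
  simpa using this

/-- Biconjugation at the boundary point `0`. -/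
lemma exists_lt_neg_fenchel (hbot : ∀ t, f t ≠ ⊥) (hf : IsConvexFun f)
    (hlsc : LowerSemicontinuous f) (hdom : Set.Ioi (0 : ℝ) ⊆ dom f) {c : ℝ}
    (hc : (c : EReal) < f 0) : ∃ z ∈ dom (fenchel f), c < -(fenchel f z).toReal := by
  obtain ⟨c', hc1, hc2⟩ := EReal.lt_iff_exists_real_btwn.1 hc
  have hcc : c < c' := by exact_mod_cast hc1
  have hev : ∀ᶠ t : ℝ in 𝓝[>] 0, (1 - t) * c < c' - t * (f 1).toReal := by
    have : ContinuousAt (fun t : ℝ => c' - t * (f 1).toReal - (1 - t) * c) 0 := by fun_prop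
    have h2 := this.eventually_const_lt (u := 0) (by simpa using hcc)
    filter_upwards [nhdsWithin_le_nhds h2] with t ht
    linarith
  have hev2 : ∀ᶠ t : ℝ in 𝓝[>] 0, (c' : EReal) < f t := nhdsWithin_le_nhds (hlsc 0 c' hc2)
  obtain ⟨t, h1, h2, h3⟩ := (hev.and (hev2.and (Ioo_mem_nhdsGT (zero_lt_one' ℝ)))).exists
  have htd : t ∈ dom f := hdom h3.1
  -- The tangent at a small t > 0 has value −f*(z) at 0. Eliminating z between equality at t and
  -- Fenchel–Young at 1 gives (1 − t)(−f*(z)) ≥ f(t) − t f(1).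
  obtain ⟨z, hz, he⟩ := exists_fenchel_eq hbot hf hdom h3.1
  have hy := fenchel_young hbot (hdom (by simp : (1 : ℝ) ∈ Set.Ioi 0)) hz
  have h2' : c' < (f t).toReal := by
    rw [← coe_toReal_of_mem_dom hbot htd] at h2
    exact_mod_cast h2
  refine ⟨z, hz, ?_⟩
  have ht := h3.1
  have : (1 - t) * c < (1 - t) * -(fenchel f z).toReal := by nlinarith
  exact lt_of_mul_lt_mul_left this (by linarith [h3.2])

/-- The recession function of `f` is the support function of the domain of the conjugate. -/
lemma tendsto_perspective (hbot : ∀ t, f t ≠ ⊥) (hf : IsConvexFun f)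
    (hdom : Set.Ioi (0 : ℝ) ⊆ dom f) {p : ℝ} (hp : 0 < p) :
    Tendsto (fun t : ℝ => (t : EReal) * f (p / t)) (𝓝[>] (0 : ℝ))
      (𝓝 (⨆ z : dom (fenchel f), ((p * z : ℝ) : EReal))) := by
  have hcoe : ∀ t : ℝ, 0 < t →
      (t : EReal) * f (p / t) = ((t * (f (p / t)).toReal : ℝ) : EReal) := fun t ht => by
    rw [EReal.coe_mul, coe_toReal_of_mem_dom hbot (hdom (div_pos hp ht))]
  rw [tendsto_order]
  constructor
  · intro c hc
    obtain ⟨⟨z, hz⟩, hcz⟩ := lt_iSup_iff.1 hc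
    have hlim : Tendsto (fun t : ℝ => ((p * z - t * (fenchel f z).toReal : ℝ) : EReal))
        (𝓝[>] 0) (𝓝 ((p * z : ℝ) : EReal)) := by
      convert tendsto_coe_nhdsGT_zero
        (u := fun t : ℝ => p * z - t * (fenchel f z).toReal) (by fun_prop) using 2
      simp
    filter_upwards [hlim.eventually_const_lt hcz, self_mem_nhdsWithin] with t ht ht0
    refine ht.trans_le ?_
    have ht0 : 0 < t := ht0
    rw [hcoe t ht0]
    have hy := fenchel_young hbot (hdom (div_pos hp ht0)) hz
    have h3 : t * (p / t * z - (f (p / t)).toReal) ≤ t * (fenchel f z).toReal :=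
      mul_le_mul_of_nonneg_left hy ht0.le
    have h4 : t * (p / t * z) = p * z := by field_simp
    exact_mod_cast (by linarith : p * z - t * (fenchel f z).toReal ≤ t * (f (p / t)).toReal)
  · intro c hc
    obtain ⟨z₁, hz₁, -⟩ := exists_fenchel_eq hbot hf hdom one_pos
    obtain ⟨r, hr1, hr2⟩ := EReal.lt_iff_exists_real_btwn.1 hc
    have hbd : ∀ z ∈ dom (fenchel f), p * z ≤ r := fun z hz => by
      have := (le_iSup (fun z : dom (fenchel f) => ((p * z : ℝ) : EReal)) ⟨z, hz⟩).trans hr1.le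
      exact_mod_cast this
    have hlim : Tendsto (fun t : ℝ => (((p - t) * (r / p) + t * (f 1).toReal : ℝ) : EReal))
        (𝓝[>] 0) (𝓝 ((r : ℝ) : EReal)) := by
      have h3 : p * (r / p) = r := by field_simp
      convert tendsto_coe_nhdsGT_zero
        (u := fun t : ℝ => (p - t) * (r / p) + t * (f 1).toReal) (by fun_prop) using 2
      simp [h3]
    filter_upwards [hlim.eventually_lt_const hr2, Ioo_mem_nhdsGT hp] with t ht hI
    refine lt_of_le_of_lt ?_ ht
    have ht0 : 0 < t := hI.1
    rw [hcoe t ht0]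
    -- Equality at p/t and Fenchel–Young at 1 give t f(p/t) ≤ (p − t) z + t f(1), and z ≤ r/p since
    -- z lies in dom f*.
    obtain ⟨z, hz, he⟩ := exists_fenchel_eq hbot hf hdom (div_pos hp ht0)
    have hy := fenchel_young hbot (hdom (by simp : (1 : ℝ) ∈ Set.Ioi 0)) hz
    have hzr : z ≤ r / p := by rw [le_div_iff₀ hp]; linarith [hbd z hz]
    have h3 : t * (f (p / t)).toReal ≤ t * (p / t * z - z + (f 1).toReal) :=
      mul_le_mul_of_nonneg_left (by linarith) ht0.le
    have h4 : t * (p / t * z) = p * z := by field_simp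
    have h5 : (p - t) * z ≤ (p - t) * (r / p) :=
      mul_le_mul_of_nonneg_left hzr (by linarith [hI.2])
    exact_mod_cast (by linarith :
      t * (f (p / t)).toReal ≤ (p - t) * (r / p) + t * (f 1).toReal)

/-- Variational formula for the summands of an `f`-divergence. -/
theorem divTerm_eq_iSup (hbot : ∀ t, f t ≠ ⊥) (hf : IsConvexFun f) (hlsc : LowerSemicontinuous f)
    (hdom : Set.Ioi (0 : ℝ) ⊆ dom f) {p q : ℝ} (hp : 0 ≤ p) (hq : 0 ≤ q) :
    divTerm f p q =
      ⨆ z : dom (fenchel f), ((p * z - q * (fenchel f z).toReal : ℝ) : EReal) := by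
  obtain ⟨z₁, hz₁, -⟩ := exists_fenchel_eq hbot hf hdom one_pos
  have : Nonempty (dom (fenchel f)) := ⟨⟨z₁, hz₁⟩⟩
  rcases hq.eq_or_lt with rfl | hq
  · rcases hp.eq_or_lt with rfl | hp
    · simp [divTerm]
    · simp only [divTerm, hp.ne', if_true, if_false]
      rw [(tendsto_perspective hbot hf hdom hp).limUnder_eq]
      simp
  · rcases hp.eq_or_lt with rfl | hp
    · simp only [divTerm, hq.ne', if_true, if_false]
      rw [(tendsto_nhdsGT_zero hbot hf hlsc hdom).limUnder_eq]
      apply le_antisymm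
      · refine le_of_forall_lt fun c hc => ?_
        obtain ⟨r, hcr, hr⟩ := EReal.lt_iff_exists_real_btwn.1 hc
        refine hcr.trans ?_
        have hr' : ((r / q : ℝ) : EReal) < f 0 := by
          by_contra! h
          have := mul_le_mul_of_nonneg_left h (by exact_mod_cast hq.le : (0 : EReal) ≤ q)
          rw [← EReal.coe_mul, mul_div_cancel₀ _ hq.ne'] at this
          exact absurd hr this.not_gt
        obtain ⟨z, hz, hlt⟩ := exists_lt_neg_fenchel hbot hf hlsc hdom hr'
        refine lt_iSup_iff.2 ⟨⟨z, hz⟩, ?_⟩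
        rw [div_lt_iff₀ hq] at hlt
        exact_mod_cast (by linarith : r < 0 * z - q * (fenchel f z).toReal)
      · refine iSup_le fun ⟨z, hz⟩ => ?_
        have : ((-(fenchel f z).toReal : ℝ) : EReal) ≤ f 0 := by
          by_cases h0 : 0 ∈ dom f
          · have := fenchel_young hbot h0 hz
            rw [← coe_toReal_of_mem_dom hbot h0]
            exact_mod_cast (by linarith)
          · exact le_top.trans_eq (not_lt_top_iff.1 h0).symm
        have := mul_le_mul_of_nonneg_left this (by exact_mod_cast hq.le : (0 : EReal) ≤ q)
        rw [← EReal.coe_mul] at this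
        simpa using this
    · simp only [divTerm, hq.ne', hp.ne', if_false]
      have hpq := div_pos hp hq
      have hd := hdom hpq
      rw [← coe_toReal_of_mem_dom hbot hd, ← EReal.coe_mul]
      have h4 : ∀ z : ℝ, q * (p / q * z) = p * z := fun z => by field_simp
      apply le_antisymm
      · obtain ⟨z, hz, he⟩ := exists_fenchel_eq hbot hf hdom hpq
        refine le_iSup_of_le ⟨z, hz⟩ ?_
        simp only [he, mul_sub, h4]
        exact_mod_cast (by linarith)
      · refine iSup_le fun ⟨z, hz⟩ => ?_
        have hy := mul_le_mul_of_nonneg_left (fenchel_young hbot hd hz) hq.le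
        rw [mul_sub, h4] at hy
        exact_mod_cast (by linarith : p * z - q * (fenchel f z).toReal ≤ q * (f (p / q)).toReal)

end Fenchel

/-! ### Sums and suprema in `EReal`. -/

lemma coe_ereal_sum {X : Type*} (F : Finset X) (u : X → ℝ) :
    ((∑ x ∈ F, u x : ℝ) : EReal) = ∑ x ∈ F, (u x : EReal) := by
  classical
  induction F using Finset.induction_on with
  | empty => simp
  | insert x F hx ih => rw [Finset.sum_insert hx, Finset.sum_insert hx, EReal.coe_add, ih]

/-- A finite sum of suprema is bounded as soon as all sums of selections are. -/
lemma sum_iSup_add_coe_le {X L : Type*} [Nonempty L] (u : X → L → ℝ) (R : EReal) (F : Finset X) :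
    ∀ c : ℝ, (∀ l : X → L, ((∑ x ∈ F, u x (l x) + c : ℝ) : EReal) ≤ R) →
      ∑ x ∈ F, (⨆ l, (u x l : EReal)) + (c : EReal) ≤ R := by
  classical
  induction F using Finset.induction_on with
  | empty => intro c h; simpa using h fun _ => Classical.arbitrary L
  | insert x F hx ih =>
    intro c h
    rw [Finset.sum_insert hx, add_assoc]
    -- A near-optimal choice `k` at `x` is real, so it can be absorbed into the constant; this is
    -- why the induction quantifies over `c`.
    refine EReal.add_le_of_forall_lt fun a ha b hb => ?_
    obtain ⟨k, hk⟩ := lt_iSup_iff.1 ha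
    refine (add_le_add hk.le hb.le).trans ?_
    rw [add_comm, add_assoc, ← EReal.coe_add]
    refine ih _ fun l => ?_
    have := h (Function.update l x k)
    rw [Finset.sum_insert hx, Function.update_self] at this
    have h2 : ∑ y ∈ F, u y (Function.update l x k y) = ∑ y ∈ F, u y (l y) :=
      Finset.sum_congr rfl fun y hy => by
        rw [Function.update_of_ne (ne_of_mem_of_not_mem hy hx)]
    rw [h2] at this
    convert this using 2
    ring

/-- A family in `EReal` with a summable real minorant is summable, and its sum is bounded when its
partial sums, completed by the tails of the minorant, are. -/
lemma tsum_le_of_summable_minorant {X : Type*} {D : X → EReal} {g : X → ℝ} {G : ℝ} {R : EReal}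
    (hgD : ∀ x, (g x : EReal) ≤ D x) (hg : HasSum g G)
    (hR : ∀ F : Finset X, ∑ x ∈ F, D x + ((G - ∑ x ∈ F, g x : ℝ) : EReal) ≤ R) :
    ∑' x, D x ≤ R := by
  -- Subtracting the minorant leaves nonnegative terms, whose partial sums converge monotonically.
  -- Adding back the finite `G` is continuous even where the supremum is `⊤`.
  let h : X → EReal := fun x => D x - g x
  have hD : ∀ x, D x = h x + g x := fun x => (EReal.sub_add_cancel).symm
  have h0 : ∀ x, 0 ≤ h x := fun x =>
    (EReal.sub_nonneg (Or.inr (EReal.coe_ne_top _)) (Or.inr (EReal.coe_ne_bot _))).2 (hgD x)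
  have hFs : ∀ F : Finset X, ∑ x ∈ F, D x = ∑ x ∈ F, h x + ((∑ x ∈ F, g x : ℝ) : EReal) := by
    intro F
    rw [coe_ereal_sum, ← Finset.sum_add_distrib]
    exact Finset.sum_congr rfl fun x _ => hD x
  have hmono : Monotone fun F : Finset X => ∑ x ∈ F, h x := fun F F' hFF' =>
    Finset.sum_le_sum_of_subset_of_nonneg hFF' fun x _ _ => h0 x
  have hT := tendsto_atTop_iSup hmono
  have hGl : Tendsto (fun F : Finset X => ((∑ x ∈ F, g x : ℝ) : EReal)) atTop (𝓝 (G : EReal)) :=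
    (continuous_coe_real_ereal.tendsto G).comp hg
  have hsum : HasSum D ((⨆ F : Finset X, ∑ x ∈ F, h x) + G) := by
    have := (EReal.continuousAt_add (p := (⨆ F : Finset X, ∑ x ∈ F, h x, (G : EReal)))
      (Or.inr (EReal.coe_ne_bot _)) (Or.inr (EReal.coe_ne_top _))).tendsto.comp
        (hT.prodMk_nhds hGl)
    rw [HasSum, SummationFilter.unconditional_filter]
    simp only [hFs]
    exact this
  refine le_of_tendsto (f := fun F : Finset X => ∑ x ∈ F, h x + (G : EReal)) ?_
    (Eventually.of_forall fun F => ?_) (b := R) (x := atTop) |> fun t => hsum.tsum_eq.trans_le t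
  · exact (EReal.continuousAt_add (p := (⨆ F : Finset X, ∑ x ∈ F, h x, (G : EReal)))
      (Or.inr (EReal.coe_ne_bot _)) (Or.inr (EReal.coe_ne_top _))).tendsto.comp
        (hT.prodMk_nhds tendsto_const_nhds)
  · have := hR F
    rwa [hFs, add_assoc, ← EReal.coe_add, add_sub_cancel] at this

/-! ### Measurements and the two bounds on the divergence. -/

variable {d : Type*} [Fintype d] [DecidableEq d]

lemma IsPOVM.hasSum_outcome {X : Type} {M : X → Matrix d d ℂ} (hM : IsPOVM M)
    (ρ : Matrix d d ℂ) : HasSum (outcome ρ M) ρ.trace.re := by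
  have hc : Continuous fun A : Matrix d d ℂ => (ρ * A).trace.re := by fun_prop
  have := hM.2.map (Complex.reAddGroupHom.comp
    ((Matrix.traceAddMonoidHom d ℂ).comp (AddMonoidHom.mulLeft ρ))) hc
  have h1 : (ρ * 1).trace.re = ρ.trace.re := by rw [Matrix.mul_one]
  exact h1 ▸ this

/-- Finitely many effects of a POVM can be completed by one further effect. -/
lemma IsPOVM.one_sub_sum_posSemidef {X : Type} {M : X → Matrix d d ℂ} (hM : IsPOVM M)
    (F : Finset X) : (1 - ∑ x ∈ F, M x).PosSemidef := by
  have hF := Matrix.posSemidef_sum F fun x _ => hM.1 x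
  refine .of_dotProduct_mulVec_nonneg (Matrix.isHermitian_one.sub hF.isHermitian) fun v => ?_
  let q : Matrix d d ℂ →+ ℂ :=
    { toFun := fun A => star v ⬝ᵥ A.mulVec v
      map_zero' := by simp
      map_add' := fun A B => by rw [Matrix.add_mulVec, dotProduct_add] }
  have hq : Continuous q := by
    change Continuous fun A : Matrix d d ℂ => star v ⬝ᵥ A.mulVec v
    fun_prop
  have := sum_le_hasSum F (fun x _ => (hM.1 x).dotProduct_mulVec_nonneg v) (hM.2.map q hq)
  change 0 ≤ q _
  rw [map_sub, map_sum]
  exact sub_nonneg.2 this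

variable {J : Set ℝ} {ψ φ : ℝ → ℝ} {ρ σ : Matrix d d ℂ}

omit [DecidableEq d] in
lemma trace_mul_sum_smul_re {ι : Type*} [Fintype ι] (ρ : Matrix d d ℂ) (c : ι → ℝ)
    (M : ι → Matrix d d ℂ) :
    (ρ * ∑ i, c i • M i).trace.re = ∑ i, (ρ * M i).trace.re * c i := by
  rw [Matrix.mul_sum, Matrix.trace_sum, Complex.re_sum]
  refine Finset.sum_congr rfl fun i _ => ?_
  rw [Matrix.mul_smul, Matrix.trace_smul, Complex.real_smul, Complex.re_ofReal_mul, mul_comm]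

/-- The linear functional evaluated at a labelled finite POVM is dominated by its value at the
Hermitian matrix averaging the labels. -/
lemma sum_le_trace_cfc (hψ : OperatorConcaveOn J ψ) (hφ : OperatorConvexOn J φ)
    (hρ : ρ.PosSemidef) (hσ : σ.PosSemidef) {ι : Type*} [Fintype ι] {M : ι → Matrix d d ℂ}
    (hM : ∀ i, (M i).PosSemidef) (hsum : ∑ i, M i = 1) {l : ι → ℝ} (hl : ∀ i, l i ∈ J) :
    ∑ i, ((ρ * M i).trace.re * ψ (l i) - (σ * M i).trace.re * φ (l i)) ≤
      (ρ * cfc ψ (∑ i, l i • M i)).trace.re - (σ * cfc φ (∑ i, l i • M i)).trace.re := by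
  have h1 := trace_mul_re_nonneg hρ (hψ.sum_smul_sub_cfc_posSemidef hM hsum hl)
  have h2 := trace_mul_re_nonneg hσ (hφ.sum_smul_sub_cfc_posSemidef hM hsum hl)
  rw [Matrix.mul_sub, Matrix.trace_sub, Complex.sub_re, trace_mul_sum_smul_re] at h1 h2
  rw [cfc_neg] at h1
  simp only [Matrix.trace_neg, Complex.neg_re, mul_neg,
    Finset.sum_neg_distrib] at h1
  rw [Finset.sum_sub_distrib]
  linarith

/-- The divergence of the outcomes of any POVM is bounded by the variational expression. -/
lemma fDiv_le_iSup_trace_cfc {f : ℝ → EReal} (hJ : J.OrdConnected) (hJne : J.Nonempty)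
    (hψ : OperatorConcaveOn J ψ) (hφ : OperatorConvexOn J φ)
    (hρ : ρ.PosSemidef) (hσ : σ.PosSemidef)
    (hf : ∀ p q : ℝ, 0 ≤ p → 0 ≤ q →
      divTerm f p q = ⨆ l : J, ((p * ψ l - q * φ l : ℝ) : EReal))
    {X : Type} {M : X → Matrix d d ℂ} (hM : IsPOVM M) :
    fDiv f (outcome ρ M) (outcome σ M) ≤
      ⨆ γ ∈ {γ : Matrix d d ℂ | γ.IsHermitian ∧ spectrum ℝ γ ⊆ J},
        (((ρ * cfc ψ γ).trace.re - (σ * cfc φ γ).trace.re : ℝ) : EReal) := by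
  obtain ⟨l₀, hl₀⟩ := hJne
  have : Nonempty J := ⟨⟨l₀, hl₀⟩⟩
  have hD : ∀ x, divTerm f (outcome ρ M x) (outcome σ M x)
      = ⨆ l : J, ((outcome ρ M x * ψ l - outcome σ M x * φ l : ℝ) : EReal) := fun x =>
    hf _ _ (trace_mul_re_nonneg hρ (hM.1 x)) (trace_mul_re_nonneg hσ (hM.1 x))
  -- The constant label `l₀` provides the summable minorant.
  have hg : HasSum (fun x => outcome ρ M x * ψ l₀ - outcome σ M x * φ l₀)
      (ρ.trace.re * ψ l₀ - σ.trace.re * φ l₀) :=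
    ((hM.hasSum_outcome ρ).mul_right _).sub ((hM.hasSum_outcome σ).mul_right _)
  refine tsum_le_of_summable_minorant (fun x => ?_) hg fun F => ?_
  · rw [hD]
    exact le_iSup (fun l : J => ((outcome ρ M x * ψ l - outcome σ M x * φ l : ℝ) : EReal))
      ⟨l₀, hl₀⟩
  simp only [hD]
  refine sum_iSup_add_coe_le
    (fun x (l : J) => outcome ρ M x * ψ l - outcome σ M x * φ l) _ F _ fun l => ?_
  -- The effects outside `F` are lumped into one, labelled `l₀`; its contribution is exactly the
  -- tail of the minorant.
  let N : Option F → Matrix d d ℂ := fun o => o.elim (1 - ∑ x ∈ F, M x) fun x => M x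
  let k : Option F → ℝ := fun o => o.elim l₀ fun x => l x
  have hN : ∀ o, (N o).PosSemidef := by
    rintro (_ | x)
    · exact hM.one_sub_sum_posSemidef F
    · exact hM.1 x
  have hk : ∀ o, k o ∈ J := by
    rintro (_ | x)
    · exact hl₀
    · exact (l x).2
  have hNsum : ∑ o, N o = 1 := by
    rw [Fintype.sum_option]
    simp only [N, Option.elim]
    rw [Finset.sum_coe_sort F M, sub_add_cancel]
  have hherm : (∑ o, k o • N o).IsHermitian := by
    simp only [Matrix.IsHermitian, Matrix.conjTranspose_sum, Matrix.conjTranspose_smul,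
      (hN _).isHermitian.eq, star_trivial]
  refine le_trans ?_ (le_iSup₂ (f := fun (γ : Matrix d d ℂ)
    (_ : γ ∈ {γ : Matrix d d ℂ | γ.IsHermitian ∧ spectrum ℝ γ ⊆ J}) =>
      (((ρ * cfc ψ γ).trace.re - (σ * cfc φ γ).trace.re : ℝ) : EReal)) (∑ o, k o • N o)
    ⟨hherm, spectrum_sum_smul_subset hJ hN hNsum hk⟩)
  refine EReal.coe_le_coe_iff.2 (le_trans (le_of_eq ?_)
    (sum_le_trace_cfc hψ hφ hρ hσ hN hNsum hk))
  have htr : ∀ τ : Matrix d d ℂ, (τ * (1 - ∑ x ∈ F, M x)).trace.re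
      = τ.trace.re - ∑ x ∈ F, outcome τ M x := by
    intro τ
    rw [Matrix.mul_sub, Matrix.mul_one, Matrix.trace_sub, Complex.sub_re, Matrix.mul_sum,
      Matrix.trace_sum, Complex.re_sum]
    rfl
  rw [Fintype.sum_option]
  simp only [N, k, Option.elim, htr]
  rw [Finset.sum_coe_sort F fun x =>
    (ρ * M x).trace.re * ψ (l x) - (σ * M x).trace.re * φ (l x)]
  simp only [Finset.sum_sub_distrib, ← Finset.sum_mul, outcome]
  ring

/-- Measuring in an eigenbasis of `γ` attains the variational expression at `γ`. -/
lemma trace_cfc_le_measuredDivProj {f : ℝ → EReal}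
    (hρ : ρ.PosSemidef) (hσ : σ.PosSemidef)
    (hf : ∀ p q : ℝ, 0 ≤ p → 0 ≤ q →
      divTerm f p q = ⨆ l : J, ((p * ψ l - q * φ l : ℝ) : EReal))
    {γ : Matrix d d ℂ} (hγ : γ.IsHermitian) (hsp : spectrum ℝ γ ⊆ J) :
    (((ρ * cfc ψ γ).trace.re - (σ * cfc φ γ).trace.re : ℝ) : EReal) ≤ measuredDivProj f ρ σ := by
  obtain ⟨n, l, M, hM, hl, hcfc⟩ := exists_spectral_resolution hγ
  refine le_trans ?_ (le_sSup ⟨Fin n, inferInstance, M, hM, rfl⟩)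
  rw [hcfc ψ, hcfc φ, trace_mul_sum_smul_re, trace_mul_sum_smul_re, ← Finset.sum_sub_distrib,
    coe_ereal_sum, fDiv, tsum_fintype]
  refine Finset.sum_le_sum fun i _ => ?_
  rw [hf (outcome ρ M i) (outcome σ M i) (trace_mul_re_nonneg hρ (hM.1.1 i)) (trace_mul_re_nonneg hσ (hM.1.1 i))]
  exact le_iSup (fun l : J => ((outcome ρ M i * ψ l - outcome σ M i * φ l : ℝ) : EReal))
    ⟨l i, hsp (hl i)⟩

lemma measuredDivProj_le_measuredDiv (f : ℝ → EReal) (ρ σ : Matrix d d ℂ) :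
    measuredDivProj f ρ σ ≤ measuredDiv f ρ σ :=
  sSup_le_sSup fun _ ⟨X, hX, M, hM, hv⟩ => ⟨X, hX, M, hM.1, hv⟩

end MeasuredDivergence

/-- `toReal` loses nothing: ψ maps J into dom f*, and f* never takes the value `⊥`. Values off J are
irrelevant, because `cfc` sees only the spectrum. -/
theorem theorem1
    (f : ℝ → EReal) (hf_ne_bot : ∀ t, f t ≠ ⊥)
    (hf_convex : MeasuredDivergence.IsConvexFun f)
    (hf_lsc : LowerSemicontinuous f)
    (hf_dom : Set.Ioi (0 : ℝ) ⊆ MeasuredDivergence.dom f)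
    (J : Set ℝ) (hJ : J.OrdConnected)
    (ψ : ℝ → ℝ)
    (hψ_bij : Set.BijOn ψ J (MeasuredDivergence.dom (MeasuredDivergence.fenchel f)))
    (hψ_concave : MeasuredDivergence.OperatorConcaveOn J ψ)
    (hψ_convex : MeasuredDivergence.OperatorConvexOn J
      (fun l => (MeasuredDivergence.fenchel f (ψ l)).toReal))
    {d : Type*} [Fintype d] [DecidableEq d]
    (ρ σ : Matrix d d ℂ) (hρ : ρ.PosSemidef) (hσ : σ.PosSemidef) :
    MeasuredDivergence.measuredDiv f ρ σ = MeasuredDivergence.measuredDivProj f ρ σ ∧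
    MeasuredDivergence.measuredDivProj f ρ σ =
      ⨆ γ ∈ {γ : Matrix d d ℂ | γ.IsHermitian ∧ spectrum ℝ γ ⊆ J},
        (((ρ * cfc ψ γ).trace.re
          - (σ * cfc (fun l => (MeasuredDivergence.fenchel f (ψ l)).toReal) γ).trace.re : ℝ) :
            EReal) := by
  have hf : ∀ p q : ℝ, 0 ≤ p → 0 ≤ q → MeasuredDivergence.divTerm f p q
      = ⨆ l : J, ((p * ψ l - q * (MeasuredDivergence.fenchel f (ψ l)).toReal : ℝ) : EReal) := by
    intro p q hp hq
    rw [MeasuredDivergence.divTerm_eq_iSup hf_ne_bot hf_convex hf_lsc hf_dom hp hq]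
    exact ((hψ_bij.equiv ψ).surjective.iSup_comp
      (fun z : MeasuredDivergence.dom (MeasuredDivergence.fenchel f) =>
        ((p * z - q * (MeasuredDivergence.fenchel f z).toReal : ℝ) : EReal))).symm
  -- A subgradient of f at 1 lies in dom f*, and ψ is onto dom f*.
  have hJne : J.Nonempty := by
    obtain ⟨z, hz, -⟩ :=
      MeasuredDivergence.exists_fenchel_eq hf_ne_bot hf_convex hf_dom one_pos
    obtain ⟨l, hl, -⟩ := hψ_bij.surjOn hz
    exact ⟨l, hl⟩
  have h1 := MeasuredDivergence.measuredDivProj_le_measuredDiv f ρ σ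
  have h2 : MeasuredDivergence.measuredDiv f ρ σ ≤ _ := sSup_le fun v ⟨X, _, M, hM, hv⟩ =>
    hv.trans_le (MeasuredDivergence.fDiv_le_iSup_trace_cfc hJ hJne hψ_concave hψ_convex hρ hσ hf hM)
  have h3 := iSup₂_le fun (γ : Matrix d d ℂ)
      (hγ : γ ∈ {γ : Matrix d d ℂ | γ.IsHermitian ∧ spectrum ℝ γ ⊆ J}) =>
    MeasuredDivergence.trace_cfc_le_measuredDivProj
      (φ := fun l => (MeasuredDivergence.fenchel f (ψ l)).toReal) hρ hσ hf hγ.1 hγ.2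
  exact ⟨le_antisymm (h2.trans h3) h1, le_antisymm (h1.trans h2) h3⟩
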